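/- **Theorem 3.1.** Let $E,F$ be Banach spaces (both real or both complex), let $f:U\to F$ be a $c^1$ map on an open set $U\subset E$, and let $x_0\in U$ be a generalized regular point of $f$. By this we mean the following: $T_0:=f'(x_0)$ is double splitting (that is, $R(T_0)$ is closed, and $N(T_0)$ and $R(T_0)$ have closed complements in $E$ and $F$), and there are a generalized inverse $T_0^+\in B(F,E)$ of $T_0$ (that is, $T_0^+T_0T_0^+=T_0^+$ and $T_0T_0^+T_0=T_0$) and a neighbourhood $V$ of $x_0$ with $R(f'(x))\cap N(T_0^+)=\{0\}$ for all $x\in V$. Let $U_0\subset U$ be any open neighbourhood of $x_0$ (for instance $U_0=U$), and consider the family of subspaces $\mathcal F=\{N(f'(x)):x\in U_0\}$. Then: 1. For every generalized inverse $T_0^+$ of $T_0$, with $E_*:=R(T_0^+)$, the co-final set $$J(x_0,E_*)=\{x\in U_0: N(f'(x))\oplus E_*=E\}$$ is trivial. That is, $x_0$ is an interior point of $J(x_0,E_*)$, and the coordinate operator $\alpha(x)\in B(N(f'(x_0)),E_*)$, $x\in J(x_0,E_*)$, which is uniquely determined by $N(f'(x))=\{e+\alpha(x)e: e\in N(f'(x_0))\}$,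 is continuous (in the operator norm) on some neighbourhood of $x_0$. 2. $\mathcal F$ is $c^1$ integrable at $x_0$. That is, there is a $c^1$ submanifold $S$ of $E$ with $x_0\in S\subset U_0$ such that for every $x\in S$ $$N(f'(x))=\{\dot c(0): c \text{ a } c^1\text{-curve in } S \text{ defined near } 0\in\mathbb R,\ c(0)=x\}.$$ Here $S\subset E$ is a $c^1$ submanifold if for each $x\in S$ there are closed subspaces $E_0,E_1$ with $E=E_0\oplus E_1$ and a $c^1$ diffeomorphism $\varphi$ of an open neighbourhood $W$ of $x$ in $E$ onto an open subset of $E$ such that $\varphi(S\cap W)$ is an open subset of $E_0$. -/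

import Mathlib

open Set Filter Topology

/-- `E = M ⊕ N` as Banach spaces: `M` and `N` are closed complementary subspaces of `E`. -/
def IsSplitting {𝕜 E : Type*} [RCLike 𝕜] [NormedAddCommGroup E] [NormedSpace 𝕜 E]
    (M N : Submodule 𝕜 E) : Prop :=
  IsClosed (M : Set E) ∧ IsClosed (N : Set E) ∧ IsCompl M N

/-- `B` is a generalized inverse of `A`: `B A B = B` and `A B A = A`. -/
def IsGeneralizedInverse {𝕜 E F : Type*} [RCLike 𝕜]
    [NormedAddCommGroup E] [NormedSpace 𝕜 E] [NormedAddCommGroup F] [NormedSpace 𝕜 F]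
    (A : E →L[𝕜] F) (B : F →L[𝕜] E) : Prop :=
  B ∘L A ∘L B = B ∧ A ∘L B ∘L A = A

/-- `A` is double splitting: its range is closed, and its kernel and its range have closed
complements. -/
def IsDoubleSplitting {𝕜 E F : Type*} [RCLike 𝕜]
    [NormedAddCommGroup E] [NormedSpace 𝕜 E] [NormedAddCommGroup F] [NormedSpace 𝕜 F]
    (A : E →L[𝕜] F) : Prop :=
  IsClosed (LinearMap.range (A : E →ₗ[𝕜] F) : Set F) ∧
    (∃ R : Submodule 𝕜 E, IsSplitting (LinearMap.ker (A : E →ₗ[𝕜] F)) R) ∧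
    ∃ N : Submodule 𝕜 F, IsSplitting (LinearMap.range (A : E →ₗ[𝕜] F)) N

/-- `x₀` is a locally fine point of the operator valued map `T`: `T` is continuous at `x₀`,
`T x₀` is double splitting, and for some generalized inverse `B` of `T x₀` one has
`R(T x) ∩ N(B) = {0}` for all `x` in a neighbourhood of `x₀`. -/
def IsLocallyFinePoint {X 𝕜 E F : Type*} [TopologicalSpace X] [RCLike 𝕜]
    [NormedAddCommGroup E] [NormedSpace 𝕜 E] [NormedAddCommGroup F] [NormedSpace 𝕜 F]
    (T : X → E →L[𝕜] F) (x₀ : X) : Prop :=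
  ContinuousAt T x₀ ∧ IsDoubleSplitting (T x₀) ∧
    ∃ B : F →L[𝕜] E, IsGeneralizedInverse (T x₀) B ∧
      ∃ V ∈ 𝓝 x₀, ∀ x ∈ V,
        LinearMap.range (T x : E →ₗ[𝕜] F) ⊓ LinearMap.ker (B : F →ₗ[𝕜] E) = ⊥

/-- `x₀` is a generalized regular point of `f`, i.e. a locally fine point of `x ↦ f'(x)`.
It is used for `f` of class `c¹` on an open set that contains `x₀`, so that the values of
`fderiv 𝕜 f` near `x₀` are the derivatives of `f`. -/
def IsGeneralizedRegularPoint (𝕜 : Type*) {E F : Type*} [RCLike 𝕜]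
    [NormedAddCommGroup E] [NormedSpace 𝕜 E] [NormedAddCommGroup F] [NormedSpace 𝕜 F]
    (f : E → F) (x₀ : E) : Prop :=
  IsLocallyFinePoint (fun x : E => fderiv 𝕜 f x) x₀

/-- The kernel family `x ↦ N(f'(x))`. -/
noncomputable def kernelFamily (𝕜 : Type*) {E F : Type*} [RCLike 𝕜]
    [NormedAddCommGroup E] [NormedSpace 𝕜 E] [NormedAddCommGroup F] [NormedSpace 𝕜 F]
    (f : E → F) (x : E) : Submodule 𝕜 E :=
  LinearMap.ker (fderiv 𝕜 f x : E →ₗ[𝕜] F)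

/-- The co-final set `J(x₀, Es) = {x ∈ Λ : M(x) ⊕ Es = E}` of the family `{M(x) : x ∈ Λ}`.
(The base point enters only through the requirement `M(x₀) ⊕ Es = E`, that is, that `x₀`
belongs to this set.) -/
def cofinalSet {𝕜 E : Type*} [RCLike 𝕜] [NormedAddCommGroup E] [NormedSpace 𝕜 E]
    (Λ : Set E) (M : E → Submodule 𝕜 E) (Es : Submodule 𝕜 E) : Set E :=
  {x | x ∈ Λ ∧ IsSplitting (M x) Es}

/-- `α ∈ B(E₀, Es)` is the coordinate operator of the subspace `E₁`:
`E₁ = {e + α e : e ∈ E₀}`. -/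
def IsCoordinateOperator {𝕜 E : Type*} [RCLike 𝕜] [NormedAddCommGroup E] [NormedSpace 𝕜 E]
    {E₀ Es : Submodule 𝕜 E} (E₁ : Submodule 𝕜 E) (α : E₀ →L[𝕜] Es) : Prop :=
  (E₁ : Set E) = {v | ∃ e : E₀, v = (e : E) + (α e : E)}

/-- The coordinate operator is unique when `E = E₀ ⊕ Es`. -/
theorem IsCoordinateOperator.unique {𝕜 E : Type*} [RCLike 𝕜] [NormedAddCommGroup E]
    [NormedSpace 𝕜 E] {E₀ Es E₁ : Submodule 𝕜 E} (h : IsSplitting E₀ Es)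
    {α β : E₀ →L[𝕜] Es} (hα : IsCoordinateOperator E₁ α) (hβ : IsCoordinateOperator E₁ β) :
    α = β := by
  ext e
  have h1 : (e : E) + (α e : E) ∈ (E₁ : Set E) := by
    rw [hα]; exact ⟨e, rfl⟩
  rw [hβ] at h1
  obtain ⟨e', he'⟩ := h1
  have h2 : ((e - e' : E₀) : E) = ((β e' - α e : Es) : E) := by
    push_cast
    rw [sub_eq_sub_iff_add_eq_add, he', add_comm]
  have h3 : ((e - e' : E₀) : E) = 0 :=
    Submodule.disjoint_def.1 h.2.2.disjoint _ (e - e').2 (h2 ▸ (β e' - α e).2)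
  have h4 : e = e' := sub_eq_zero.1 (Subtype.ext h3)
  subst h4
  exact add_left_cancel he'

/-- The co-final set `J(x₀, Es)` is trivial: `x₀` is an inner point of it, and the coordinate
operator `α(x) ∈ B(M(x₀), Es)` of `M(x)`, `x ∈ J(x₀, Es)`, is continuous (for the operator norm)
in some neighbourhood of `x₀`. The values of `α` on `J(x₀, Es)` are unique, those outside of it
play no role. -/
def IsTrivialCofinalSet {𝕜 E : Type*} [RCLike 𝕜] [NormedAddCommGroup E] [NormedSpace 𝕜 E]
    (Λ : Set E) (M : E → Submodule 𝕜 E) (x₀ : E) (Es : Submodule 𝕜 E) : Prop :=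
  x₀ ∈ interior (cofinalSet Λ M Es) ∧
    ∃ α : E → (M x₀ →L[𝕜] Es),
      (∀ x ∈ cofinalSet Λ M Es, IsCoordinateOperator (M x) (α x)) ∧
      ∃ V ∈ 𝓝 x₀, V ⊆ cofinalSet Λ M Es ∧ ContinuousOn α V

/-- `S` is a `c¹` submanifold of the Banach space `E`: around each of its points there is a `c¹`
diffeomorphism `φ` between open sets of `E` that maps the part of `S` in its domain onto an open
set of a subspace `E₀` that splits in `E`. -/
def IsC1Submanifold (𝕜 : Type*) {E : Type*} [RCLike 𝕜] [NormedAddCommGroup E] [NormedSpace 𝕜 E]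
    (S : Set E) : Prop :=
  ∀ x ∈ S, ∃ E₀ E₁ : Submodule 𝕜 E, IsSplitting E₀ E₁ ∧
    ∃ φ : OpenPartialHomeomorph E E, x ∈ φ.source ∧
      ContDiffOn 𝕜 1 φ φ.source ∧ ContDiffOn 𝕜 1 φ.symm φ.target ∧
      ∃ W : Set E, IsOpen W ∧ φ '' (S ∩ φ.source) = W ∩ (E₀ : Set E)

/-- The set of velocities `c'(0)` of the `c¹` curves `c : (-ε, ε) → E` in `S` with `c 0 = x`. -/
def tangentSet {E : Type*} [NormedAddCommGroup E] [NormedSpace ℝ E] (S : Set E) (x : E) :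
    Set E :=
  {v | ∃ c : ℝ → E, ∃ ε > 0, ContDiffOn ℝ 1 c (Ioo (-ε) ε) ∧ (∀ t ∈ Ioo (-ε) ε, c t ∈ S) ∧
    c 0 = x ∧ HasDerivAt c v 0}

/-- The family `{M(x) : x ∈ Λ}` is `c¹` integrable at `x₀`: there is a `c¹` submanifold `S ⊆ Λ`
through `x₀` (the integral submanifold) that is tangent to `M(x)` at each of its points `x`. -/
def IsC1IntegrableAt {𝕜 E : Type*} [RCLike 𝕜] [NormedAddCommGroup E] [NormedSpace 𝕜 E]
    [NormedSpace ℝ E] (Λ : Set E) (M : E → Submodule 𝕜 E) (x₀ : E) : Prop :=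
  ∃ S : Set E, S ⊆ Λ ∧ x₀ ∈ S ∧ IsC1Submanifold 𝕜 S ∧
    ∀ x ∈ S, (M x : Set E) = tangentSet S x

/-!
Let `B` be a generalized inverse of `T₀ = f'(x₀)` with `R(f'(x)) ∩ N(B) = 0` for `x` near `x₀`. The
operator `D(x) = 1 + B (f'(x) - T₀)` is close to the identity and satisfies
`D(x)⁻¹ N(T₀) = N(f'(x))` and `D(x)⁻¹ R(B) = R(B)`, so it carries the splitting
`E = N(f'(x)) ⊕ R(B)` to `E = N(T₀) ⊕ R(B)`, and `D(x)⁻¹ - 1` on `N(T₀)` is the coordinate operator.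
Moreover `D(x)` is the derivative at `x` of the local diffeomorphism
`φ(x) = x - x₀ + B (f x - f x₀ - T₀ (x - x₀))`, hence `φ⁻¹(N(T₀))` is an integral submanifold.
For an arbitrary generalized inverse `P` of `T₀`, replace `B` by `P T₀ B`, which is a generalized
inverse with range `R(P)` and kernel `N(B)`.
-/

open scoped ContDiff Ring

section GeneralizedInverse

variable {𝕜 E F : Type*} [RCLike 𝕜] [NormedAddCommGroup E] [NormedSpace 𝕜 E]
  [NormedAddCommGroup F] [NormedSpace 𝕜 F] {A S : E →L[𝕜] F} {B P : F →L[𝕜] E}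

namespace IsGeneralizedInverse

theorem apply_apply_left (hB : IsGeneralizedInverse A B) (y : F) : B (A (B y)) = B y :=
  DFunLike.congr_fun hB.1 y

theorem apply_apply_right (hB : IsGeneralizedInverse A B) (v : E) : A (B (A v)) = A v :=
  DFunLike.congr_fun hB.2 v

theorem isIdempotentElem_comp (hB : IsGeneralizedInverse A B) : IsIdempotentElem (B ∘L A) :=
  ContinuousLinearMap.ext fun v => hB.apply_apply_left (A v)

theorem ker_comp (hB : IsGeneralizedInverse A B) :
    LinearMap.ker ((B ∘L A : E →L[𝕜] E) : E →ₗ[𝕜] E) = LinearMap.ker (A : E →ₗ[𝕜] F) := by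
  refine le_antisymm (fun v (hv : B (A v) = 0) => ?_) (LinearMap.ker_le_ker_comp _ _)
  change A v = 0
  rw [← hB.apply_apply_right, hv, map_zero]

theorem range_comp (hB : IsGeneralizedInverse A B) :
    LinearMap.range ((B ∘L A : E →L[𝕜] E) : E →ₗ[𝕜] E) = LinearMap.range (B : F →ₗ[𝕜] E) :=
  le_antisymm (LinearMap.range_comp_le_range _ _)
    (by rintro _ ⟨y, rfl⟩; exact ⟨B y, hB.apply_apply_left y⟩)

theorem isSplitting_ker_range (hB : IsGeneralizedInverse A B) :
    IsSplitting (LinearMap.ker (A : E →ₗ[𝕜] F)) (LinearMap.range (B : F →ₗ[𝕜] E)) := by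
  have hidem := hB.isIdempotentElem_comp
  refine ⟨A.isClosed_ker, ?_, ?_⟩
  · rw [← hB.range_comp]
    exact ContinuousLinearMap.IsIdempotentElem.isClosed_range hidem
  · rw [← hB.ker_comp, ← hB.range_comp]
    exact (LinearMap.IsIdempotentElem.isCompl
      (ContinuousLinearMap.isIdempotentElem_toLinearMap_iff.2 hidem)).symm

theorem comp_comp (hP : IsGeneralizedInverse A P) (hB : IsGeneralizedInverse A B) :
    IsGeneralizedInverse A (P ∘L A ∘L B) := by
  constructor <;> ext v
  · simp [hP.apply_apply_left, hB.apply_apply_right]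
  · simp [hP.apply_apply_right, hB.apply_apply_right]

theorem range_comp_comp (hP : IsGeneralizedInverse A P) (hB : IsGeneralizedInverse A B) :
    LinearMap.range ((P ∘L A ∘L B : F →L[𝕜] E) : F →ₗ[𝕜] E) =
      LinearMap.range (P : F →ₗ[𝕜] E) := by
  refine le_antisymm (LinearMap.range_comp_le_range _ _) ?_
  rintro _ ⟨y, rfl⟩
  refine ⟨A (P y), ?_⟩
  simp [hB.apply_apply_right, hP.apply_apply_left]

theorem ker_comp_comp (hP : IsGeneralizedInverse A P) (hB : IsGeneralizedInverse A B) :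
    LinearMap.ker ((P ∘L A ∘L B : F →L[𝕜] E) : F →ₗ[𝕜] E) = LinearMap.ker (B : F →ₗ[𝕜] E) := by
  ext y
  refine ⟨fun (hy : P (A (B y)) = 0) => ?_, fun (hy : B y = 0) => by simp [hy]⟩
  change B y = 0
  rw [← hB.apply_apply_left, ← hP.apply_apply_right, hy, map_zero, map_zero]

end IsGeneralizedInverse

/-- The operator `1 + B (S - A)` that compares `S` with `A` through a generalized inverse `B` of
`A`; the literature on generalized inverses writes it `D_A(A⁺, S)`. -/
noncomputable def transferOperator (A : E →L[𝕜] F) (B : F →L[𝕜] E) (S : E →L[𝕜] F) : E →L[𝕜] E :=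
  1 + B ∘L (S - A)

theorem transferOperator_apply (v : E) : transferOperator A B S v = v + B (S v - A v) :=
  rfl

theorem transferOperator_self (A : E →L[𝕜] F) (B : F →L[𝕜] E) : transferOperator A B A = 1 := by
  simp [transferOperator]

theorem continuous_transferOperator (A : E →L[𝕜] F) (B : F →L[𝕜] E) :
    Continuous (transferOperator A B) := by
  unfold transferOperator
  fun_prop

theorem comap_range_transferOperator :
    (LinearMap.range (B : F →ₗ[𝕜] E)).comap (transferOperator A B S : E →ₗ[𝕜] E) =
      LinearMap.range (B : F →ₗ[𝕜] E) :=
  Submodule.ext fun _ => Submodule.add_mem_iff_left _ (LinearMap.mem_range_self _ _)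

theorem IsGeneralizedInverse.comap_ker_transferOperator (hB : IsGeneralizedInverse A B)
    (hS : Disjoint (LinearMap.range (S : E →ₗ[𝕜] F)) (LinearMap.ker (B : F →ₗ[𝕜] E))) :
    (LinearMap.ker (A : E →ₗ[𝕜] F)).comap (transferOperator A B S : E →ₗ[𝕜] E) =
      LinearMap.ker (S : E →ₗ[𝕜] F) := by
  have hA (v : E) : A (transferOperator A B S v) = A (B (S v)) := by
    simp [transferOperator_apply, hB.apply_apply_right]
  ext v
  change A (transferOperator A B S v) = 0 ↔ S v = 0
  rw [hA]
  refine ⟨fun hv => ?_, fun hv => by simp [hv]⟩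
  have hBS : B (S v) = 0 := by rw [← hB.apply_apply_left, hv, map_zero]
  exact Submodule.disjoint_def.1 hS _ (LinearMap.mem_range_self _ v) hBS

end GeneralizedInverse

section CoordinateOperator

variable {𝕜 E F : Type*} [RCLike 𝕜] [NormedAddCommGroup E] [NormedSpace 𝕜 E]
  [NormedAddCommGroup F] [NormedSpace 𝕜 F]

theorem IsSplitting.comap {M N : Submodule 𝕜 F} (h : IsSplitting M N) (L : E ≃L[𝕜] F) :
    IsSplitting (M.comap (L : E →ₗ[𝕜] F)) (N.comap (L : E →ₗ[𝕜] F)) :=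
  ⟨h.1.preimage L.continuous, h.2.1.preimage L.continuous,
    (Submodule.orderIsoMapComap L.toLinearEquiv).symm.isCompl h.2.2⟩

theorem isCoordinateOperator_of_forall_mem {E₀ E₁ Es : Submodule 𝕜 E} {α : E₀ →L[𝕜] Es}
    (h₀ : Codisjoint E₀ Es) (h₁ : Disjoint E₁ Es) (hα : ∀ e : E₀, (e + α e : E) ∈ E₁) :
    IsCoordinateOperator E₁ α := by
  refine Set.Subset.antisymm (fun v hv => ?_) (by rintro _ ⟨e, rfl⟩; exact hα e)
  obtain ⟨e, he, s, hs, rfl⟩ := Submodule.mem_sup.1 (h₀.eq_top ▸ Submodule.mem_top (x := v))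
  have hsα : s - α ⟨e, he⟩ ∈ E₁ := by
    simpa only [add_sub_add_left_eq_sub] using E₁.sub_mem hv (hα ⟨e, he⟩)
  have hs_eq : s = α ⟨e, he⟩ :=
    sub_eq_zero.1 (Submodule.disjoint_def.1 h₁ _ hsα (Es.sub_mem hs (α ⟨e, he⟩).2))
  exact ⟨⟨e, he⟩, congrArg (e + ·) hs_eq⟩

theorem IsSplitting.exists_isCoordinateOperator [CompleteSpace E] {E₀ E₁ Es : Submodule 𝕜 E}
    (h₀ : IsSplitting E₀ Es) (h₁ : IsSplitting E₁ Es) :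
    ∃ α : E₀ →L[𝕜] Es, IsCoordinateOperator E₁ α := by
  have htop : Submodule.IsTopCompl Es E₁ :=
    Submodule.IsCompl.isTopCompl_of_isClosed h₁.2.2.symm h₁.2.1 h₁.1
  refine ⟨-(Es.projectionOntoL E₁ htop ∘L E₀.subtypeL),
    isCoordinateOperator_of_forall_mem h₀.2.2.codisjoint h₁.2.2.disjoint fun e => ?_⟩
  rw [← Submodule.projectionOntoL_apply_eq_zero_iff htop, map_add,
    Submodule.projectionOntoL_apply_left htop]
  exact add_neg_cancel _

/-- Triviality of a co-final set only has to be checked near the base point: further away, the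
closed graph theorem provides the coordinate operators. -/
theorem isTrivialCofinalSet_of_continuousOn [CompleteSpace E] {Λ V : Set E}
    {M : E → Submodule 𝕜 E} {x₀ : E} {Es : Submodule 𝕜 E} (hV : V ∈ 𝓝 x₀)
    (hVJ : V ⊆ cofinalSet Λ M Es) {β : E → (M x₀ →L[𝕜] Es)} (hβ : ContinuousOn β V)
    (hβM : ∀ x ∈ V, IsCoordinateOperator (M x) (β x)) :
    IsTrivialCofinalSet Λ M x₀ Es := by
  have h₀ : IsSplitting (M x₀) Es := (hVJ (mem_of_mem_nhds hV)).2
  have hex (x : E) : ∃ α : M x₀ →L[𝕜] Es,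
      x ∈ cofinalSet Λ M Es → IsCoordinateOperator (M x) α := by
    by_cases hx : x ∈ cofinalSet Λ M Es
    · exact (h₀.exists_isCoordinateOperator hx.2).imp fun _ hα _ => hα
    · exact ⟨0, fun h => absurd h hx⟩
  choose α hα using hex
  exact ⟨mem_interior_iff_mem_nhds.2 (mem_of_superset hV hVJ), α, hα, V, hV, hVJ,
    hβ.congr fun x hx => (hα x (hVJ hx)).unique h₀ (hβM x hx)⟩

variable {A S : E →L[𝕜] F} {B : F →L[𝕜] E}

/-- The coordinate operator of `N(S)` with respect to `E = N(A) ⊕ R(B)`, for `B` a generalized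
inverse of `A` and `S` close to `A`. It is `D⁻¹ - 1`, restricted to `N(A)`, for
`D = transferOperator A B S`; the formula uses `D - 1 = B (S - A)` to make it take values
in `R(B)`. It is a junk value unless `D` is invertible. -/
noncomputable def kernelCoordinate (A : E →L[𝕜] F) (B : F →L[𝕜] E) (S : E →L[𝕜] F) :
    LinearMap.ker (A : E →ₗ[𝕜] F) →L[𝕜] LinearMap.range (B : F →ₗ[𝕜] E) :=
  -(B.codRestrict (LinearMap.range (B : F →ₗ[𝕜] E)) (LinearMap.mem_range_self _) ∘L (S - A) ∘L
    (transferOperator A B S)⁻¹ʳ ∘L (LinearMap.ker (A : E →ₗ[𝕜] F)).subtypeL)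

theorem add_kernelCoordinate_apply (hD : IsUnit (transferOperator A B S))
    (e : LinearMap.ker (A : E →ₗ[𝕜] F)) :
    (e + kernelCoordinate A B S e : E) = (transferOperator A B S)⁻¹ʳ e := by
  set u := (transferOperator A B S)⁻¹ʳ (e : E)
  have he : u + B (S u - A u) = e :=
    DFunLike.congr_fun (Ring.mul_inverse_cancel _ hD) (e : E)
  change (e : E) + -B (S u - A u) = u
  rw [← he, add_neg_cancel_right]

theorem continuousAt_kernelCoordinate [CompleteSpace E] (hD : IsUnit (transferOperator A B S)) :
    ContinuousAt (kernelCoordinate A B) S := by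
  have hinv : ContinuousAt (fun S => (transferOperator A B S)⁻¹ʳ) S := by
    obtain ⟨u, hu⟩ := hD
    refine ContinuousAt.comp (g := Ring.inverse) ?_ (continuous_transferOperator A B).continuousAt
    exact hu ▸ NormedRing.inverse_continuousAt u
  exact (continuousAt_const.clm_comp ((continuousAt_id.sub continuousAt_const).clm_comp
    (hinv.clm_comp continuousAt_const))).neg

namespace IsGeneralizedInverse

theorem isSplitting_ker_of_isUnit (hB : IsGeneralizedInverse A B)
    (hS : Disjoint (LinearMap.range (S : E →ₗ[𝕜] F)) (LinearMap.ker (B : F →ₗ[𝕜] E)))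
    (hD : IsUnit (transferOperator A B S)) :
    IsSplitting (LinearMap.ker (S : E →ₗ[𝕜] F)) (LinearMap.range (B : F →ₗ[𝕜] E)) := by
  obtain ⟨u, hu⟩ := hD
  have hsplit := hB.isSplitting_ker_range.comap (ContinuousLinearEquiv.ofUnit u)
  rwa [show ((ContinuousLinearEquiv.ofUnit u : E ≃L[𝕜] E) : E →ₗ[𝕜] E) =
      (transferOperator A B S : E →ₗ[𝕜] E) from hu ▸ rfl,
    hB.comap_ker_transferOperator hS, comap_range_transferOperator] at hsplit

theorem isCoordinateOperator_kernelCoordinate (hB : IsGeneralizedInverse A B)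
    (hS : Disjoint (LinearMap.range (S : E →ₗ[𝕜] F)) (LinearMap.ker (B : F →ₗ[𝕜] E)))
    (hD : IsUnit (transferOperator A B S)) :
    IsCoordinateOperator (LinearMap.ker (S : E →ₗ[𝕜] F)) (kernelCoordinate A B S) := by
  refine isCoordinateOperator_of_forall_mem hB.isSplitting_ker_range.2.2.codisjoint
    (hB.isSplitting_ker_of_isUnit hS hD).2.2.disjoint fun e => ?_
  rw [add_kernelCoordinate_apply hD, ← hB.comap_ker_transferOperator hS, Submodule.mem_comap]
  convert e.2
  exact DFunLike.congr_fun (Ring.mul_inverse_cancel _ hD) (e : E)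

theorem isTrivialCofinalSet_ker [CompleteSpace E] {T : E → E →L[𝕜] F} {Λ : Set E} {x₀ : E}
    (hΛ : Λ ∈ 𝓝 x₀) (hT : ∀ᶠ x in 𝓝 x₀, ContinuousAt T x)
    (hB : IsGeneralizedInverse (T x₀) B)
    (hTB : ∀ᶠ x in 𝓝 x₀,
      Disjoint (LinearMap.range (T x : E →ₗ[𝕜] F)) (LinearMap.ker (B : F →ₗ[𝕜] E))) :
    IsTrivialCofinalSet Λ (fun x => LinearMap.ker (T x : E →ₗ[𝕜] F)) x₀
      (LinearMap.range (B : F →ₗ[𝕜] E)) := by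
  have hunit : ∀ᶠ x in 𝓝 x₀, IsUnit (transferOperator (T x₀) B (T x)) := by
    have hunit₀ : IsUnit (transferOperator (T x₀) B (T x₀)) :=
      (transferOperator_self (T x₀) B).symm ▸ isUnit_one
    exact ((continuous_transferOperator _ B).continuousAt.comp hT.self_of_nhds).eventually_mem
      (Units.isOpen.mem_nhds hunit₀)
  have hV := (eventually_mem_set.2 hΛ).and (hT.and (hTB.and hunit))
  refine isTrivialCofinalSet_of_continuousOn hV ?_
    (β := fun x => kernelCoordinate (T x₀) B (T x)) ?_ ?_
  · rintro x ⟨hxΛ, -, hxB, hxD⟩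
    exact ⟨hxΛ, hB.isSplitting_ker_of_isUnit hxB hxD⟩
  · rintro x ⟨-, hxT, -, hxD⟩
    exact ((continuousAt_kernelCoordinate hxD).comp hxT).continuousWithinAt
  · rintro x ⟨-, -, hxB, hxD⟩
    exact hB.isCoordinateOperator_kernelCoordinate hxB hxD

end IsGeneralizedInverse

end CoordinateOperator

section IntegralSubmanifold

variable {𝕜 E G : Type*} [RCLike 𝕜] [NormedAddCommGroup E] [NormedSpace 𝕜 E]
  [NormedAddCommGroup G] [NormedSpace 𝕜 G]

theorem exists_openPartialHomeomorph_contDiffOn [CompleteSpace E] {n : ℕ∞ω} (hn₀ : n ≠ 0)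
    (hn : n ≠ ∞) {φ : E → G} {x₀ : E} (hφ : ContDiffAt 𝕜 n φ x₀) {L : E ≃L[𝕜] G}
    (hL : HasFDerivAt φ (L : E →L[𝕜] G) x₀) {N : Set E} (hN : N ∈ 𝓝 x₀) :
    ∃ e : OpenPartialHomeomorph E G, (e : E → G) = φ ∧ x₀ ∈ e.source ∧ e.source ⊆ N ∧
      ContDiffOn 𝕜 n e e.source ∧ ContDiffOn 𝕜 n e.symm e.target := by
  set e₀ := hφ.toOpenPartialHomeomorph φ hL hn₀
  have hx₀ : x₀ ∈ e₀.source := hφ.mem_toOpenPartialHomeomorph_source hL hn₀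
  have hsymm : ContDiffAt 𝕜 n e₀.symm (e₀ x₀) := hφ.to_localInverse hL hn₀
  exact ⟨(e₀.restr N).restrContDiff 𝕜 n hn, rfl,
    ⟨⟨hx₀, mem_interior_iff_mem_nhds.2 hN⟩, hφ, hsymm⟩, fun x hx => interior_subset hx.1.2,
    OpenPartialHomeomorph.contDiffOn_restrContDiff_source 𝕜 _ hn,
    OpenPartialHomeomorph.contDiffOn_restrContDiff_target 𝕜 _ hn⟩

theorem isC1Submanifold_source_inter_preimage {e : OpenPartialHomeomorph E E}
    (he : ContDiffOn 𝕜 1 e e.source) (hesymm : ContDiffOn 𝕜 1 e.symm e.target)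
    {E₀ E₁ : Submodule 𝕜 E} (hsplit : IsSplitting E₀ E₁) :
    IsC1Submanifold 𝕜 (e.source ∩ e ⁻¹' E₀) := by
  refine fun x hx => ⟨E₀, E₁, hsplit, e, hx.1, he, hesymm, e.target, e.open_target, ?_⟩
  rw [inter_right_comm, inter_self, image_inter_preimage, e.image_source_eq_target]

theorem fderiv_symm_fderiv_apply {e : OpenPartialHomeomorph E G} {x : E} (hx : x ∈ e.source)
    (he : DifferentiableAt 𝕜 e x) (hesymm : DifferentiableAt 𝕜 e.symm (e x)) (v : E) :
    fderiv 𝕜 e.symm (e x) (fderiv 𝕜 e x v) = v := by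
  have hcomp := hesymm.hasFDerivAt.comp x he.hasFDerivAt
  have hid : HasFDerivAt (e.symm ∘ e) (ContinuousLinearMap.id 𝕜 E) x :=
    (hasFDerivAt_id x).congr_of_eventuallyEq (e.eventually_left_inverse hx)
  exact DFunLike.congr_fun (hcomp.unique hid) v

variable [NormedSpace ℝ E] [IsScalarTower ℝ 𝕜 E] [NormedSpace ℝ G] [IsScalarTower ℝ 𝕜 G]

theorem hasDerivAt_mem_of_eventually_mem {E₀ : Submodule 𝕜 E} (hE₀ : IsClosed (E₀ : Set E))
    {c : ℝ → E} {v : E} {t : ℝ} (hc : HasDerivAt c v t) (hmem : ∀ᶠ s in 𝓝 t, c s ∈ E₀) :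
    v ∈ E₀ := by
  refine hE₀.mem_of_tendsto hc.tendsto_slope ((hmem.filter_mono nhdsWithin_le_nhds).mono ?_)
  exact fun s hs => E₀.smul_of_tower_mem _ (E₀.sub_mem hs hmem.self_of_nhds)

theorem tangentSet_subset_comap_fderiv {φ : E → G} {S : Set E} {x : E} (hφ : DifferentiableAt 𝕜 φ x)
    {G₀ : Submodule 𝕜 G} (hG₀ : IsClosed (G₀ : Set G)) (hS : MapsTo φ S G₀) :
    tangentSet S x ⊆ G₀.comap (fderiv 𝕜 φ x : E →ₗ[𝕜] G) := by
  rintro v ⟨c, ε, hε, -, hcS, rfl, hcv⟩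
  refine hasDerivAt_mem_of_eventually_mem hG₀
    ((hφ.hasFDerivAt.restrictScalars ℝ).comp_hasDerivAt 0 hcv) ?_
  filter_upwards [Ioo_mem_nhds (neg_lt_zero.2 hε) hε] with t ht using hS (hcS t ht)

theorem comap_fderiv_subset_tangentSet {e : OpenPartialHomeomorph E G} {G₀ : Submodule 𝕜 G} {x : E}
    (hx : x ∈ e.source ∩ e ⁻¹' G₀) (he : DifferentiableAt 𝕜 e x)
    (hesymm : ContDiffOn 𝕜 1 e.symm e.target) :
    (G₀.comap (fderiv 𝕜 e x : E →ₗ[𝕜] G) : Set E) ⊆ tangentSet (e.source ∩ e ⁻¹' G₀) x := by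
  intro v (hv : fderiv 𝕜 e x v ∈ G₀)
  set line : ℝ → G := fun t => e x + t • fderiv 𝕜 e x v with hline
  have hline₀ : line 0 = e x := by simp [hline]
  have hline_mem (t : ℝ) : line t ∈ G₀ := G₀.add_mem hx.2 (G₀.smul_of_tower_mem t hv)
  have hline_smooth : ContDiff ℝ 1 line := contDiff_const.add (contDiff_id.smul contDiff_const)
  have hline_deriv : HasDerivAt line (fderiv 𝕜 e x v) 0 := by
    simpa [hline] using ((hasDerivAt_id (0 : ℝ)).smul_const (fderiv 𝕜 e x v)).const_add (e x)
  have htarget : e.target ∈ 𝓝 (e x) := e.open_target.mem_nhds (e.map_source hx.1)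
  obtain ⟨ε, hε, hball⟩ := Metric.mem_nhds_iff.1
    (hline_smooth.continuous.continuousAt.preimage_mem_nhds (hline₀.symm ▸ htarget))
  rw [Real.ball_eq_Ioo, zero_sub, zero_add] at hball
  refine ⟨e.symm ∘ line, ε, hε, ?_, fun t ht => ⟨e.map_target (hball ht), ?_⟩, ?_, ?_⟩
  · exact (hesymm.restrict_scalars ℝ).comp hline_smooth.contDiffOn hball
  · simpa [e.right_inv (hball ht)] using hline_mem t
  · rw [Function.comp_apply, hline₀, e.left_inv hx.1]
  · have hd : DifferentiableAt 𝕜 e.symm (e x) :=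
      (hesymm.contDiffAt htarget).differentiableAt one_ne_zero
    have hd' : HasFDerivAt e.symm ((fderiv 𝕜 e.symm (e x)).restrictScalars ℝ) (line 0) :=
      hline₀.symm ▸ hd.hasFDerivAt.restrictScalars ℝ
    simpa only [ContinuousLinearMap.coe_restrictScalars', fderiv_symm_fderiv_apply hx.1 he hd]
      using hd'.comp_hasDerivAt 0 hline_deriv

theorem isC1IntegrableAt_of_eventually_eq_comap_fderiv [CompleteSpace E] {M : E → Submodule 𝕜 E}
    {Λ : Set E} {x₀ : E} (hΛ : Λ ∈ 𝓝 x₀) {φ : E → E} (hφ : ContDiffAt 𝕜 1 φ x₀) {L : E ≃L[𝕜] E}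
    (hL : HasFDerivAt φ (L : E →L[𝕜] E) x₀) {E₀ E₁ : Submodule 𝕜 E} (hsplit : IsSplitting E₀ E₁)
    (hφx₀ : φ x₀ ∈ E₀) (hM : ∀ᶠ x in 𝓝 x₀, M x = E₀.comap (fderiv 𝕜 φ x : E →ₗ[𝕜] E)) :
    IsC1IntegrableAt Λ M x₀ := by
  obtain ⟨e, rfl, hx₀, hsource, he, hesymm⟩ :=
    exists_openPartialHomeomorph_contDiffOn one_ne_zero (by decide) hφ hL (inter_mem hΛ hM)
  refine ⟨e.source ∩ e ⁻¹' E₀, fun x hx => (hsource hx.1).1, ⟨hx₀, hφx₀⟩,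
    isC1Submanifold_source_inter_preimage he hesymm hsplit, fun x hx => ?_⟩
  have hd : DifferentiableAt 𝕜 e x :=
    (he.contDiffAt (e.open_source.mem_nhds hx.1)).differentiableAt one_ne_zero
  rw [(hsource hx.1).2]
  exact (comap_fderiv_subset_tangentSet hx hd hesymm).antisymm
    (tangentSet_subset_comap_fderiv hd hsplit.1 inter_subset_right)

end IntegralSubmanifold

section RegularPoint

variable {𝕜 E F : Type*} [RCLike 𝕜] [NormedAddCommGroup E] [NormedSpace 𝕜 E]
  [NormedAddCommGroup F] [NormedSpace 𝕜 F]

/-- The local diffeomorphism at `x₀` that straightens the kernels of `f'` to `N(f'(x₀))`, for `B` a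
generalized inverse of `f'(x₀)`. It is translated so as to map `x₀` to `0`. -/
noncomputable def straightening (f : E → F) (B : F →L[𝕜] E) (x₀ x : E) : E :=
  x - x₀ + B (f x - f x₀ - fderiv 𝕜 f x₀ (x - x₀))

theorem straightening_self (f : E → F) (B : F →L[𝕜] E) (x₀ : E) : straightening f B x₀ x₀ = 0 := by
  simp [straightening]

theorem contDiffAt_straightening {n : ℕ∞ω} {f : E → F} {x : E} (hf : ContDiffAt 𝕜 n f x)
    (B : F →L[𝕜] E) (x₀ : E) : ContDiffAt 𝕜 n (straightening f B x₀) x := by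
  unfold straightening
  fun_prop

theorem hasFDerivAt_straightening {f : E → F} {x : E} (hf : DifferentiableAt 𝕜 f x)
    (B : F →L[𝕜] E) (x₀ : E) :
    HasFDerivAt (straightening f B x₀)
      (transferOperator (fderiv 𝕜 f x₀) B (fderiv 𝕜 f x)) x := by
  have hsub : HasFDerivAt (fun y : E => y - x₀) (1 : E →L[𝕜] E) x := (hasFDerivAt_id x).sub_const x₀
  exact hsub.add (B.hasFDerivAt.comp x ((hf.hasFDerivAt.sub_const (f x₀)).sub
    ((fderiv 𝕜 f x₀).hasFDerivAt.comp x hsub)))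

theorem isC1IntegrableAt_kernelFamily [CompleteSpace E] [NormedSpace ℝ E] [IsScalarTower ℝ 𝕜 E]
    {f : E → F} {Λ : Set E} {x₀ : E} (hΛ : Λ ∈ 𝓝 x₀) (hf : ContDiffAt 𝕜 1 f x₀) {B : F →L[𝕜] E}
    (hB : IsGeneralizedInverse (fderiv 𝕜 f x₀) B)
    (hfB : ∀ᶠ x in 𝓝 x₀,
      Disjoint (LinearMap.range (fderiv 𝕜 f x : E →ₗ[𝕜] F)) (LinearMap.ker (B : F →ₗ[𝕜] E))) :
    IsC1IntegrableAt Λ (kernelFamily 𝕜 f) x₀ := by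
  have hderiv₀ : HasFDerivAt (straightening f B x₀)
      ((ContinuousLinearEquiv.refl 𝕜 E : E ≃L[𝕜] E) : E →L[𝕜] E) x₀ := by
    have h := hasFDerivAt_straightening (hf.differentiableAt one_ne_zero) B x₀
    rwa [transferOperator_self] at h
  refine isC1IntegrableAt_of_eventually_eq_comap_fderiv hΛ (contDiffAt_straightening hf B x₀)
    hderiv₀ hB.isSplitting_ker_range (straightening_self f B x₀ ▸ Submodule.zero_mem _) ?_
  filter_upwards [hfB, hf.eventually (by decide)] with x hxB hxf
  rw [(hasFDerivAt_straightening (hxf.differentiableAt one_ne_zero) B x₀).fderiv,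
    hB.comap_ker_transferOperator hxB, kernelFamily]

theorem IsLocallyFinePoint.exists_eventually_disjoint {X : Type*} [TopologicalSpace X]
    {T : X → E →L[𝕜] F} {x₀ : X} (hfine : IsLocallyFinePoint T x₀) {P : F →L[𝕜] E}
    (hP : IsGeneralizedInverse (T x₀) P) :
    ∃ B : F →L[𝕜] E, IsGeneralizedInverse (T x₀) B ∧
      LinearMap.range (B : F →ₗ[𝕜] E) = LinearMap.range (P : F →ₗ[𝕜] E) ∧
      ∀ᶠ x in 𝓝 x₀,
        Disjoint (LinearMap.range (T x : E →ₗ[𝕜] F)) (LinearMap.ker (B : F →ₗ[𝕜] E)) := by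
  obtain ⟨-, -, B, hB, V, hV, hVB⟩ := hfine
  refine ⟨P ∘L T x₀ ∘L B, hP.comp_comp hB, hP.range_comp_comp hB, ?_⟩
  rw [hP.ker_comp_comp hB]
  exact mem_of_superset hV fun x hx => disjoint_iff.2 (hVB x hx)

end RegularPoint

theorem theorem3p1_general {𝕜 E F : Type*} [RCLike 𝕜]
    [NormedAddCommGroup E] [NormedSpace 𝕜 E] [CompleteSpace E]
    [NormedSpace ℝ E] [IsScalarTower ℝ 𝕜 E] [NormedAddCommGroup F] [NormedSpace 𝕜 F]
    {f : E → F} {x₀ : E} (hf : ContDiffAt 𝕜 1 f x₀) (hreg : IsGeneralizedRegularPoint 𝕜 f x₀)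
    {U₀ : Set E} (hU₀ : U₀ ∈ 𝓝 x₀) :
    (∀ T₀p : F →L[𝕜] E, IsGeneralizedInverse (fderiv 𝕜 f x₀) T₀p →
      IsTrivialCofinalSet U₀ (kernelFamily 𝕜 f) x₀ (LinearMap.range (T₀p : F →ₗ[𝕜] E))) ∧
    IsC1IntegrableAt U₀ (kernelFamily 𝕜 f) x₀ := by
  have hcont : ∀ᶠ x in 𝓝 x₀, ContinuousAt (fderiv 𝕜 f) x :=
    (hf.eventually (by decide)).mono fun x hx => hx.continuousAt_fderiv one_ne_zero
  have hfine : IsLocallyFinePoint (fderiv 𝕜 f) x₀ := hreg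
  constructor
  · intro T₀p hT₀p
    obtain ⟨B, hB, hrange, hdisj⟩ := hfine.exists_eventually_disjoint hT₀p
    rw [← hrange]
    exact hB.isTrivialCofinalSet_ker hU₀ hcont hdisj
  · obtain ⟨-, -, P, hP, -⟩ := hreg
    obtain ⟨B, hB, -, hdisj⟩ := hfine.exists_eventually_disjoint hP
    exact isC1IntegrableAt_kernelFamily hU₀ hf hB hdisj

theorem theorem3p1 {𝕜 E F : Type*} [RCLike 𝕜]
    [NormedAddCommGroup E] [NormedSpace 𝕜 E] [CompleteSpace E]
    [NormedSpace ℝ E] [IsScalarTower ℝ 𝕜 E]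
    [NormedAddCommGroup F] [NormedSpace 𝕜 F] [CompleteSpace F]
    (U : Set E) (hU : IsOpen U) (f : E → F) (hf : ContDiffOn 𝕜 1 f U)
    (x₀ : E) (hx₀ : x₀ ∈ U) (hreg : IsGeneralizedRegularPoint 𝕜 f x₀)
    (U₀ : Set E) (hU₀ : IsOpen U₀) (hx₀U₀ : x₀ ∈ U₀) (hU₀U : U₀ ⊆ U) :
    (∀ T₀p : F →L[𝕜] E, IsGeneralizedInverse (fderiv 𝕜 f x₀) T₀p →
      IsTrivialCofinalSet U₀ (kernelFamily 𝕜 f) x₀ (LinearMap.range (T₀p : F →ₗ[𝕜] E))) ∧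
    IsC1IntegrableAt U₀ (kernelFamily 𝕜 f) x₀ := by
  exact theorem3p1_general (hf.contDiffAt (hU.mem_nhds hx₀)) hreg (hU₀.mem_nhds hx₀U₀)
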